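/- Let $c$ be a real number with $c < \sqrt{\log 2}$ ($\approx 0.833$), where $\log$ is the natural logarithm. Let $S$ be the set of $m \in \mathbb{N}$ such that \[ \binom{m+k}{m}\ \Big|\ \binom{2m}{m} \] for all integers $k$ with $0 \le k \le \exp(c\sqrt{\log m})$. Then $S$ has asymptotic density $1$, that is, \[ \lim_{N\to\infty} \frac{\#\{m \in S : 1 \le m \le N\}}{N} = 1 . \] -/

import Mathlib

/-- A set `S` of natural numbers has asymptotic (natural) density `d`:
`#{m ∈ S : 1 ≤ m ≤ N} / N → d` as `N → ∞`. -/
def HasAsymptoticDensity (S : Set ℕ) (d : ℝ) : Prop :=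
  Filter.Tendsto (fun N : ℕ => ((S ∩ Set.Icc 1 N).ncard : ℝ) / (N : ℝ)) Filter.atTop (nhds d)

/-! By Kummer's theorem, compare carries in `m + k` and `m + m` in each base `p`. If `p > 2k`, every
carry of the first is one of the second. If `p ≤ 2k`, many carries in `m + k` force a high power of
`p` to divide some `m + i` with `1 ≤ i ≤ k`, while each digit of `m` that is at least `p / 2` gives
a carry in `m + m`.

Put `x = √(log N)` and `Y = exp (c x)`. A union bound over `p ≤ 2Y` and `i ≤ Y` disposes of `p ^ J ≥
Y ^ 3` dividing `m + i`. A Chernoff bound shows that fewer than `J` large digits has probability at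
most about `2 ^ (-x / c)` for the largest `p`, since `m` has about `x ^ 2 / log p` digits. This
beats the `2Y` primes exactly when `c ^ 2 < log 2`. -/

open Finset in
/-- The number of the `D` lowest base-`p` digits `d` of `m` with `p ≤ 2 * d`. -/
def largeDigitCount (p D m : ℕ) : ℕ :=
  ∑ i ∈ range D, if p ≤ 2 * (m / p ^ i % p) then 1 else 0

/-! ### Carries and divisibility -/

theorem pow_le_two_mul_mod_of_le_two_mul_digit {p m i : ℕ} (h : p ≤ 2 * (m / p ^ i % p)) :
    p ^ (i + 1) ≤ 2 * (m % p ^ (i + 1)) := by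
  rw [pow_succ, Nat.mod_mul]
  calc p ^ i * p ≤ p ^ i * (2 * (m / p ^ i % p)) := Nat.mul_le_mul_left _ h
    _ ≤ 2 * (m % p ^ i + p ^ i * (m / p ^ i % p)) := by
      have := Nat.zero_le (m % p ^ i)
      nlinarith

open Finset in
theorem largeDigitCount_le_factorization {p : ℕ} (hp : p.Prime) (D m : ℕ) :
    largeDigitCount p D m ≤ ((2 * m).choose m).factorization p := by
  -- Adding `D` to the cutoff keeps all positions `i + 1` with `i < D` in range.
  have hb : Nat.log p (m + m) < Nat.log p (m + m) + 1 + D := by omega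
  rw [two_mul, Nat.factorization_choose' hp hb, largeDigitCount, ← card_filter]
  apply card_le_card_of_injOn (fun i => i + 1)
  · intro i hi
    simp only [coe_filter, mem_range, Set.mem_ofPred_eq, mem_Ico] at hi ⊢
    have := pow_le_two_mul_mod_of_le_two_mul_digit hi.2
    exact ⟨by omega, by omega⟩
  · intro a _ b _ h
    simpa using h

-- A carry at `p ^ i` with `k < p ^ i / 2` forces `m % p ^ i > p ^ i / 2`.
open Finset in
theorem factorization_choose_add_le_of_two_mul_lt {p m k : ℕ} (hp : p.Prime) (hk : 2 * k < p) :
    ((m + k).choose m).factorization p ≤ ((2 * m).choose m).factorization p := by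
  have h1 : Nat.log p (k + m) < Nat.log p (k + m) + Nat.log p (m + m) + 1 := by omega
  have h2 : Nat.log p (m + m) < Nat.log p (k + m) + Nat.log p (m + m) + 1 := by omega
  rw [two_mul, Nat.factorization_choose' hp h2, add_comm m k, Nat.factorization_choose' hp h1]
  apply card_le_card
  intro i hi
  simp only [mem_filter, mem_Ico] at hi ⊢
  have h3 : p ≤ p ^ i := Nat.le_self_pow (by omega) p
  have h4 := Nat.mod_le k (p ^ i)
  exact ⟨hi.1, by omega⟩

-- The highest carry position `t` is at least the number of carries, and a carry there means that at
-- most `k` must be added to `m` to reach a multiple of `p ^ t`.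
open Finset in
theorem exists_pow_factorization_choose_add_dvd {p m k : ℕ} (hp : p.Prime)
    (h : 0 < ((m + k).choose m).factorization p) :
    ∃ i, 1 ≤ i ∧ i ≤ k ∧ p ^ ((m + k).choose m).factorization p ∣ m + i := by
  rw [add_comm m k, Nat.factorization_choose' hp (Nat.lt_succ_self _)] at h ⊢
  set s := {i ∈ Ico 1 (Nat.log p (k + m)).succ | p ^ i ≤ m % p ^ i + k % p ^ i} with hs
  have hne : s.Nonempty := card_pos.mp h
  have hmem := s.max'_mem hne
  set t := s.max' hne with ht
  have hcard : #s ≤ t := by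
    have : s ⊆ Icc 1 t := fun i hi => by
      have h1 := s.le_max' i hi
      simp only [hs, mem_filter, mem_Ico] at hi
      exact mem_Icc.mpr ⟨hi.1.1, h1⟩
    simpa using card_le_card this
  simp only [hs, mem_filter, mem_Ico] at hmem
  have hlt : m % p ^ t < p ^ t := Nat.mod_lt _ (pow_pos hp.pos _)
  have hle : k % p ^ t ≤ k := Nat.mod_le _ _
  refine ⟨p ^ t - m % p ^ t, by omega, by omega, (pow_dvd_pow p hcard).trans ?_⟩
  have h1 := Nat.div_add_mod m (p ^ t)
  refine ⟨m / p ^ t + 1, ?_⟩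
  rw [mul_add, mul_one]
  omega

theorem choose_add_dvd_choose_two_mul {m k : ℕ}
    (h : ∀ p : ℕ, p.Prime → p ≤ 2 * k → ∃ J D : ℕ,
      (∀ i, 1 ≤ i → i ≤ k → ¬ p ^ J ∣ m + i) ∧ J ≤ largeDigitCount p D m) :
    (m + k).choose m ∣ (2 * m).choose m := by
  rw [← Nat.factorization_prime_le_iff_dvd (Nat.choose_pos (by omega)).ne'
    (Nat.choose_pos (by omega)).ne']
  intro p hp
  rcases lt_or_ge (2 * k) p with hpk | hpk
  · exact factorization_choose_add_le_of_two_mul_lt hp hpk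
  obtain ⟨J, D, h1, h2⟩ := h p hp hpk
  refine le_trans ?_ (h2.trans (largeDigitCount_le_factorization hp D m))
  by_contra! hlt
  obtain ⟨i, hi1, hik, hdvd⟩ := exists_pow_factorization_choose_add_dvd hp ((Nat.zero_le J).trans_lt hlt)
  exact h1 i hi1 hik ((pow_dvd_pow p hlt.le).trans hdvd)

/-! ### Counting exceptional integers -/

theorem largeDigitCount_mul_add {p r : ℕ} (hr : r < p) (D q : ℕ) :
    largeDigitCount p (D + 1) (p * q + r) =
      (if p ≤ 2 * r then 1 else 0) + largeDigitCount p D q := by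
  rw [largeDigitCount, Finset.sum_range_succ', add_comm, largeDigitCount]
  congr 1
  · simp [Nat.mod_eq_of_lt hr]
  · refine Finset.sum_congr rfl fun i _ => ?_
    rw [pow_succ', ← Nat.div_div_eq_div_mul, Nat.mul_add_div (by omega), Nat.div_eq_of_lt hr,
      add_zero]

open Finset in
theorem sum_range_mul_eq_sum_sum (f : ℕ → ℝ) (p n : ℕ) :
    ∑ m ∈ range (p * n), f m = ∑ q ∈ range n, ∑ r ∈ range p, f (p * q + r) := by
  induction n with
  | zero => simp
  | succ n ih => rw [mul_add, mul_one, sum_range_add, ih, sum_range_succ]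

-- Over full blocks of length `p ^ D` the digits are independent, so the generating function
-- factors.
open Finset in
theorem sum_pow_largeDigitCount (z : ℝ) (p D M : ℕ) :
    ∑ m ∈ range (p ^ D * M), z ^ largeDigitCount p D m =
      M * (∑ r ∈ range p, z ^ (if p ≤ 2 * r then 1 else 0)) ^ D := by
  induction D with
  | zero => simp [largeDigitCount]
  | succ D ih =>
    have : p ^ (D + 1) * M = p * (p ^ D * M) := by ring
    rw [this, sum_range_mul_eq_sum_sum]
    have : ∀ q ∈ range (p ^ D * M),
        ∑ r ∈ range p, z ^ largeDigitCount p (D + 1) (p * q + r) =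
          (∑ r ∈ range p, z ^ (if p ≤ 2 * r then 1 else 0)) * z ^ largeDigitCount p D q := by
      intro q _
      rw [sum_mul]
      refine sum_congr rfl fun r hr => ?_
      rw [largeDigitCount_mul_add (mem_range.mp hr), pow_add]
    rw [sum_congr rfl this, ← mul_sum, ih]
    ring

open Finset in
theorem sum_range_pow_ite_le {z : ℝ} (hz0 : 0 ≤ z) (hz1 : z ≤ 1) (p : ℕ) :
    ∑ r ∈ range p, z ^ (if p ≤ 2 * r then 1 else 0) ≤ (1 + p + p * z) / 2 := by
  have h1 : ∀ r ∈ range p, z ^ (if p ≤ 2 * r then 1 else 0) =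
      z + if r < (p + 1) / 2 then 1 - z else 0 := by
    intro r _
    by_cases h : p ≤ 2 * r
    · rw [if_pos h, if_neg (by omega)]; simp
    · rw [if_neg h, if_pos (by omega)]; simp
  rw [sum_congr rfl h1, sum_add_distrib, ← sum_filter, sum_const, sum_const, card_range,
    nsmul_eq_mul, nsmul_eq_mul]
  have h2 : (#{r ∈ range p | r < (p + 1) / 2} : ℝ) ≤ (p + 1) / 2 := by
    have : #{r ∈ range p | r < (p + 1) / 2} ≤ (p + 1) / 2 := by
      calc _ ≤ #(range ((p + 1) / 2)) := card_le_card fun r hr => by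
            simp only [mem_filter, mem_range] at hr ⊢; exact hr.2
        _ = _ := card_range _
    calc _ ≤ (((p + 1) / 2 : ℕ) : ℝ) := by exact_mod_cast this
      _ ≤ _ := by simpa using (Nat.cast_div_le (α := ℝ) (m := p + 1) (n := 2))
  nlinarith [mul_le_mul_of_nonneg_right h2 (sub_nonneg.mpr hz1)]

-- Chernoff's method: weight `m` by `z ^ (count - J)`, which is at least `1` on the set counted.
open Finset in
theorem card_largeDigitCount_lt_le {z : ℝ} (hz0 : 0 < z) (hz1 : z ≤ 1) {p D J N : ℕ}
    (hp : 0 < p) (hN : p ^ D ≤ N) :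
    (#{m ∈ Icc 1 N | largeDigitCount p D m < J} : ℝ) ≤
      2 * N * (z⁻¹ ^ J * ((1 + 1 / p + z) / 2) ^ D) := by
  have hpR : (0 : ℝ) < p := by exact_mod_cast hp
  set M := N / p ^ D + 1 with hM
  have hlt : N < p ^ D * M := by
    rw [mul_comm]
    exact Nat.lt_mul_of_div_lt (Nat.lt_succ_self _) (pow_pos hp D)
  have h1 : (#{m ∈ Icc 1 N | largeDigitCount p D m < J} : ℝ) * z ^ J ≤
      M * ((1 + p + p * z) / 2) ^ D := by
    calc (#{m ∈ Icc 1 N | largeDigitCount p D m < J} : ℝ) * z ^ J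
        = ∑ m ∈ Icc 1 N with largeDigitCount p D m < J, z ^ J := by
          rw [sum_const, nsmul_eq_mul]
      _ ≤ ∑ m ∈ Icc 1 N with largeDigitCount p D m < J, z ^ largeDigitCount p D m :=
          sum_le_sum fun m hm =>
            pow_le_pow_of_le_one hz0.le hz1 (mem_filter.mp hm).2.le
      _ ≤ ∑ m ∈ range (p ^ D * M), z ^ largeDigitCount p D m :=
          sum_le_sum_of_subset_of_nonneg
            (fun m hm => by simp only [mem_filter, mem_Icc, mem_range] at hm ⊢; omega)
            fun _ _ _ => by positivity
      _ ≤ _ := by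
          rw [sum_pow_largeDigitCount]
          gcongr
          exact sum_range_pow_ite_le hz0.le hz1 p
  have h2 : (M : ℝ) * p ^ D ≤ 2 * N := by
    have : M * p ^ D ≤ 2 * N := by
      have := Nat.div_mul_le_self N (p ^ D)
      rw [hM, add_mul, one_mul]
      omega
    exact_mod_cast this
  have h3 : (1 + p + p * z) / 2 = p * ((1 + 1 / p + z) / 2) := by
    field_simp
    ring
  rw [h3, mul_pow, ← mul_assoc] at h1
  have h4 : (#{m ∈ Icc 1 N | largeDigitCount p D m < J} : ℝ) * z ^ J ≤
      2 * N * ((1 + 1 / p + z) / 2) ^ D := h1.trans (by gcongr)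
  rw [← le_div_iff₀ (by positivity)] at h4
  refine h4.trans_eq ?_
  rw [inv_pow]
  field_simp

open Finset in
theorem card_dvd_add_le {q i N : ℕ} (hi : i ≤ N) :
    (#{m ∈ Icc 1 N | q ∣ m + i} : ℝ) ≤ 2 * N / q := by
  have h1 : #{m ∈ Icc 1 N | q ∣ m + i} ≤ (N + i) / q := by
    rw [← Nat.Ioc_filter_dvd_card_eq_div]
    apply card_le_card_of_injOn (fun m => m + i)
    · intro m hm
      simp only [coe_filter, mem_Icc, Set.mem_ofPred_eq, mem_Ioc] at hm ⊢
      exact ⟨by omega, hm.2⟩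
    · intro a _ b _ h
      simpa using h
  calc (#{m ∈ Icc 1 N | q ∣ m + i} : ℝ) ≤ (((N + i) / q : ℕ) : ℝ) := by exact_mod_cast h1
    _ ≤ ((N + i : ℕ) : ℝ) / q := Nat.cast_div_le
    _ ≤ 2 * N / q := by
      gcongr
      have : (i : ℝ) ≤ N := by exact_mod_cast hi
      push_cast; linarith

/-! ### Exponential estimates uniform in the prime -/

open Real Filter in
theorem inv_pow_mul_pow_le_exp {z ρ c d x ℓ : ℝ} {J D : ℕ} (hz0 : 0 < z) (hz1 : z ≤ 1)
    (hρ0 : 0 < ρ) (hρ1 : ρ ≤ 1) (hℓ : 0 < ℓ) (hx : 0 ≤ x) (hJ : (J : ℝ) ≤ 1 + 3 * c * x / ℓ)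
    (hD : x ^ 2 < (D + 1) * ℓ) (h : 3 * c * -log z + d * ℓ ≤ -log ρ * x) :
    z⁻¹ ^ J * ρ ^ D ≤ exp (-log z + -log ρ) * exp (-(d * x)) := by
  have hw : 0 ≤ -log z := by linarith [log_nonpos hz0.le hz1]
  have hl : 0 ≤ -log ρ := by linarith [log_nonpos hρ0.le hρ1]
  have h1 : z⁻¹ ^ J * ρ ^ D = exp (J * -log z + D * log ρ) := by
    rw [exp_add, ← log_inv, mul_comm (J : ℝ), mul_comm (D : ℝ), ← rpow_def_of_pos (by positivity),
      ← rpow_def_of_pos hρ0, rpow_natCast, rpow_natCast]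
  rw [h1, ← exp_add, exp_le_exp]
  have h2 : x ^ 2 / ℓ - 1 ≤ D := by
    have : x ^ 2 / ℓ < D + 1 := by rwa [div_lt_iff₀ hℓ]
    linarith
  have h3 := mul_le_mul_of_nonneg_right hJ hw
  have h4 := mul_le_mul_of_nonneg_right h2 hl
  have h5 : d * x ≤ (-log ρ * x ^ 2 - 3 * c * x * -log z) / ℓ := by
    rw [le_div_iff₀ hℓ]
    nlinarith [mul_le_mul_of_nonneg_left h hx]
  have h6 : (-log ρ * x ^ 2 - 3 * c * x * -log z) / ℓ =
      x ^ 2 / ℓ * -log ρ - 3 * c * x / ℓ * -log z := by ring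
  nlinarith

open Real Filter in
theorem exists_uniform_exp_bound {c : ℝ} (hc0 : 0 < c) (hc : c ^ 2 < log 2) :
    ∃ z C d : ℝ, 0 < z ∧ z ≤ 1 ∧ 0 < C ∧ c < d ∧ ∀ᶠ x : ℝ in atTop, ∀ p J D : ℕ,
      2 ≤ p → log p ≤ log 2 + c * x → (J : ℝ) ≤ 1 + 3 * c * x / log p →
      x ^ 2 < (D + 1) * log p →
      z⁻¹ ^ J * ((1 + 1 / p + z) / 2) ^ D ≤ C * exp (-(d * x)) := by
  obtain ⟨δ, hδ0, hδ1, hδ⟩ : ∃ δ : ℝ, 0 < δ ∧ δ < 1 / 2 ∧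
      (c ^ 2 + log 2) / 2 < -log ((1 + δ) / 2) := by
    have hcont : ContinuousAt (fun δ : ℝ => -log ((1 + δ) / 2)) 0 := by
      refine (ContinuousAt.log (by fun_prop) (by norm_num)).neg
    have h0 : (c ^ 2 + log 2) / 2 < -log ((1 + (0 : ℝ)) / 2) := by
      rw [add_zero, one_div, log_inv]; linarith
    have h1 := (hcont.eventually_const_lt h0).filter_mono
      (nhdsWithin_le_nhds (s := Set.Ioi (0 : ℝ)))
    obtain ⟨δ, h4, h2, h3⟩ :=
      (h1.and (Ioo_mem_nhdsGT (show (0 : ℝ) < 1 / 2 by norm_num))).exists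
    exact ⟨δ, h2, h3, h4⟩
  -- If `1 / p ≤ δ / 2`, this `z` makes the base at most `ρ`. The remaining `p` are bounded, so any
  -- base below `1` suffices; `p ≥ 2` and `z ≤ 1 / 4` give `7 / 8`.
  set z := δ / 2 with hz
  -- `d * c` is the midpoint of `c ^ 2` and `log 2`, so `c < d` and `d * c < -log ρ`.
  set d := (c ^ 2 + log 2) / 2 / c with hd
  have hdc : d * c = (c ^ 2 + log 2) / 2 := div_mul_cancel₀ _ hc0.ne'
  set ρ := (1 + δ) / 2 with hρ
  have hlρ : 0 < -log ρ := by nlinarith [sq_nonneg c]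
  have hl7 : 0 < -log (7 / 8 : ℝ) := by
    linarith [log_neg (x := 7 / 8) (by norm_num) (by norm_num)]
  have hlz : 0 < -log z := by
    linarith [log_neg (x := z) (by positivity) (by rw [hz]; linarith)]
  have hd0 : 0 < d := by
    have : 0 < log 2 := log_pos (by norm_num)
    positivity
  have hcd : c < d := by
    rw [hd, lt_div_iff₀ hc0]; nlinarith
  refine ⟨z, exp (-log z + (-log ρ + -log (7 / 8))), d, by positivity, by rw [hz]; linarith,
    exp_pos _, hcd, ?_⟩
  have e1 : ∀ᶠ x : ℝ in atTop,
      3 * c * -log z + d * log 2 ≤ (-log ρ - d * c) * x :=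
    (tendsto_id.const_mul_atTop (by rw [hdc]; linarith)).eventually_ge_atTop _
  have e2 : ∀ᶠ x : ℝ in atTop,
      3 * c * -log z + d * log (2 / δ) ≤ -log (7 / 8) * x :=
    (tendsto_id.const_mul_atTop hl7).eventually_ge_atTop _
  filter_upwards [e1, e2, eventually_ge_atTop 0] with x h1 h2 hx p J D hp hpx hJ hD
  have hp2 : (2 : ℝ) ≤ p := by exact_mod_cast hp
  have hℓ : 0 < log p := log_pos (by linarith)
  have hz0 : 0 < z := by positivity
  have hz1 : z ≤ 1 := by rw [hz]; linarith
  rcases le_total (1 / (p : ℝ)) (δ / 2) with hpδ | hpδ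
  · calc _ ≤ z⁻¹ ^ J * ρ ^ D := by
          gcongr
          rw [hρ, hz]; linarith
      _ ≤ exp (-log z + -log ρ) * exp (-(d * x)) := by
          apply inv_pow_mul_pow_le_exp hz0 hz1 (by positivity) (by rw [hρ]; linarith) hℓ hx hJ hD
          nlinarith [mul_le_mul_of_nonneg_left hpx hd0.le]
      _ ≤ _ := by gcongr; linarith
  · have hle : log p ≤ log (2 / δ) := by
      apply log_le_log (by linarith)
      rw [div_le_div_iff₀ (by norm_num) (by linarith)] at hpδ
      rw [le_div_iff₀ hδ0]; linarith
    have hhalf : 1 / (p : ℝ) ≤ 1 / 2 := one_div_le_one_div_of_le (by norm_num) hp2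
    calc _ ≤ z⁻¹ ^ J * (7 / 8) ^ D := by
          have : (1 + 1 / (p : ℝ) + z) / 2 ≤ 7 / 8 := by rw [hz]; linarith
          gcongr
      _ ≤ exp (-log z + -log (7 / 8)) * exp (-(d * x)) := by
          apply inv_pow_mul_pow_le_exp hz0 hz1 (by norm_num) (by norm_num) hℓ hx hJ hD
          nlinarith [mul_le_mul_of_nonneg_left hle hd0.le]
      _ ≤ _ := by gcongr; linarith

/-! ### Union bound and density -/

open Real Finset in
theorem card_not_choose_dvd_le {c x z B : ℝ} {N : ℕ} (hc : 0 < c) (hN : 0 < N)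
    (hx : x = √(log N)) (hcx : c ≤ x) (hz0 : 0 < z) (hz1 : z ≤ 1) (hB : 0 ≤ B)
    (h : ∀ p J D : ℕ, 2 ≤ p → log p ≤ log 2 + c * x → (J : ℝ) ≤ 1 + 3 * c * x / log p →
      x ^ 2 < (D + 1) * log p → z⁻¹ ^ J * ((1 + 1 / p + z) / 2) ^ D ≤ B)
    (bad : Finset ℕ) (hbad : ∀ m ∈ bad, m ∈ Icc 1 N ∧
      ∃ k : ℕ, (k : ℝ) ≤ exp (c * √(log m)) ∧ ¬ (m + k).choose m ∣ (2 * m).choose m) :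
    (#bad : ℝ) ≤ N * (4 * exp (-(c * x)) + 4 * exp (c * x) * B) := by
  set Y := exp (c * x) with hY
  have hY0 : 0 < Y := exp_pos _
  have hx0 : 0 ≤ x := hx ▸ sqrt_nonneg _
  have hN1 : (1 : ℝ) ≤ N := by exact_mod_cast hN
  have hxsq : x ^ 2 = log N := by rw [hx, sq_sqrt (log_nonneg hN1)]
  have hYN : Y ≤ N := by
    rw [hY, ← le_log_iff_exp_le (by linarith), ← hxsq]
    nlinarith
  -- The `3` gives `p ^ J p ≥ Y ^ 3`, which outweighs the roughly `2 * Y ^ 2` pairs `(p, i)`.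
  let J : ℕ → ℕ := fun p => ⌈3 * c * x / log p⌉₊
  let D : ℕ → ℕ := fun p => Nat.log p N
  let P : Finset ℕ := {p ∈ Icc 1 ⌊2 * Y⌋₊ | p.Prime}
  have hsub : bad ⊆ P.biUnion fun p =>
      ((Icc 1 ⌊Y⌋₊).biUnion fun i => {m ∈ Icc 1 N | p ^ J p ∣ m + i}) ∪
        {m ∈ Icc 1 N | largeDigitCount p (D p) m < J p} := by
    intro m hm
    obtain ⟨hmN, k, hk, hdvd⟩ := hbad m hm
    have hm1 : 1 ≤ m := (mem_Icc.mp hmN).1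
    have hmR : (1 : ℝ) ≤ m := by exact_mod_cast hm1
    have hkY : (k : ℝ) ≤ Y := by
      refine hk.trans (exp_le_exp.mpr ?_)
      rw [hx]
      have : (m : ℝ) ≤ N := by exact_mod_cast (mem_Icc.mp hmN).2
      gcongr
    by_contra hnot
    refine hdvd (choose_add_dvd_choose_two_mul fun p hp hpk => ⟨J p, D p, ?_⟩)
    have hpP : p ∈ P := by
      refine mem_filter.mpr ⟨mem_Icc.mpr ⟨hp.one_le, Nat.le_floor ?_⟩, hp⟩
      have : (p : ℝ) ≤ 2 * k := by exact_mod_cast hpk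
      linarith
    simp only [mem_biUnion, mem_union, mem_filter, not_exists, not_and, not_or, not_lt] at hnot
    obtain ⟨h1, h2⟩ := hnot p hpP
    refine ⟨fun i hi hik => h1 i (mem_Icc.mpr ⟨hi, hik.trans (Nat.le_floor hkY)⟩) hmN, h2 hmN⟩
  have hterm : ∀ p ∈ P, (#(((Icc 1 ⌊Y⌋₊).biUnion fun i => {m ∈ Icc 1 N | p ^ J p ∣ m + i}) ∪
        {m ∈ Icc 1 N | largeDigitCount p (D p) m < J p}) : ℝ) ≤
      Y * (2 * N / Y ^ 3) + 2 * N * B := by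
    intro p hpP
    obtain ⟨hpI, hp⟩ := mem_filter.mp hpP
    have hp2 : (2 : ℝ) ≤ p := by exact_mod_cast hp.two_le
    have hℓ : 0 < log p := log_pos (by linarith)
    have hpY : (p : ℝ) ≤ 2 * Y := (Nat.le_floor_iff (by positivity)).mp (mem_Icc.mp hpI).2
    have hlp : log p ≤ log 2 + c * x := by
      rw [← log_exp (c * x), ← log_mul (by norm_num) (exp_pos _).ne']
      exact log_le_log (by linarith) hpY
    have hJ : (J p : ℝ) ≤ 1 + 3 * c * x / log p := by
      have := Nat.ceil_lt_add_one (a := 3 * c * x / log p) (by positivity)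
      linarith
    have hJpow : Y ^ 3 ≤ (p : ℝ) ^ J p := by
      have h1 : 3 * c * x ≤ J p * log p := by
        rw [← div_le_iff₀ hℓ]; exact Nat.le_ceil _
      rw [← exp_log (show (0 : ℝ) < (p : ℝ) ^ J p by positivity), log_pow, hY, ← exp_nat_mul]
      apply exp_le_exp.mpr
      push_cast; linarith
    have hD : x ^ 2 < (D p + 1) * log p := by
      have h1 : N < p ^ (D p + 1) := Nat.lt_pow_succ_log_self hp.one_lt N
      have h2 : (N : ℝ) < (p : ℝ) ^ (D p + 1) := by exact_mod_cast h1
      have h3 := log_lt_log (by linarith) h2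
      rw [log_pow] at h3
      push_cast at h3
      rwa [hxsq]
    have hB1 := h p (J p) (D p) hp.two_le hlp hJ hD
    have hfirst : (#((Icc 1 ⌊Y⌋₊).biUnion fun i => {m ∈ Icc 1 N | p ^ J p ∣ m + i}) : ℝ) ≤
        Y * (2 * N / Y ^ 3) := by
      calc _ ≤ ((∑ i ∈ Icc 1 ⌊Y⌋₊, #{m ∈ Icc 1 N | p ^ J p ∣ m + i} : ℕ) : ℝ) := by
            exact_mod_cast card_biUnion_le
        _ ≤ ∑ i ∈ Icc 1 ⌊Y⌋₊, 2 * N / Y ^ 3 := by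
            push_cast
            refine sum_le_sum fun i hi => ?_
            have hiN : i ≤ N := (mem_Icc.mp hi).2.trans (Nat.floor_le_of_le hYN)
            refine (card_dvd_add_le hiN).trans ?_
            push_cast
            gcongr
        _ ≤ _ := by
            rw [sum_const, nsmul_eq_mul, Nat.card_Icc, Nat.add_sub_cancel]
            gcongr
            exact Nat.floor_le hY0.le
    have hsecond := (card_largeDigitCount_lt_le (J := J p) hz0 hz1 hp.pos
      (Nat.pow_log_le_self p hN.ne')).trans (mul_le_mul_of_nonneg_left hB1 (by positivity))
    calc _ ≤ (#((Icc 1 ⌊Y⌋₊).biUnion fun i => {m ∈ Icc 1 N | p ^ J p ∣ m + i}) : ℝ) +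
          #{m ∈ Icc 1 N | largeDigitCount p (D p) m < J p} := by
            exact_mod_cast card_union_le _ _
      _ ≤ _ := add_le_add hfirst hsecond
  have hP : (#P : ℝ) ≤ 2 * Y := by
    calc (#P : ℝ) ≤ (⌊2 * Y⌋₊ : ℝ) := by
          have := card_filter_le (Icc 1 ⌊2 * Y⌋₊) Nat.Prime
          rw [Nat.card_Icc, Nat.add_sub_cancel] at this
          exact_mod_cast this
      _ ≤ 2 * Y := Nat.floor_le (by positivity)
  calc (#bad : ℝ) ≤ ∑ p ∈ P, (Y * (2 * N / Y ^ 3) + 2 * N * B) := by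
        refine le_trans ?_ (sum_le_sum hterm)
        exact_mod_cast (card_le_card hsub).trans card_biUnion_le
    _ ≤ 2 * Y * (Y * (2 * N / Y ^ 3) + 2 * N * B) := by
        rw [sum_const, nsmul_eq_mul]
        gcongr
    _ = _ := by
        rw [exp_neg, ← hY]
        field_simp
        ring

theorem ncard_inter_Icc_div_le_one (S : Set ℕ) (N : ℕ) :
    ((S ∩ Set.Icc 1 N).ncard : ℝ) / N ≤ 1 := by
  apply div_le_one_of_le₀ _ (Nat.cast_nonneg N)
  have := Set.ncard_le_ncard (Set.inter_subset_right (s := S)) (Set.finite_Icc 1 N)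
  rw [← Finset.coe_Icc, Set.ncard_coe_finset, Nat.card_Icc, Nat.add_sub_cancel] at this
  exact_mod_cast this

theorem HasAsymptoticDensity.mono_one {S T : Set ℕ} (h : HasAsymptoticDensity S 1) (hST : S ⊆ T) :
    HasAsymptoticDensity T 1 := by
  refine tendsto_of_tendsto_of_tendsto_of_le_of_le h tendsto_const_nhds (fun N => ?_)
    (ncard_inter_Icc_div_le_one T)
  have := Set.ncard_le_ncard (Set.inter_subset_inter_left (Set.Icc 1 N) hST)
    ((Set.finite_Icc 1 N).subset Set.inter_subset_right)
  dsimp only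
  gcongr

open Real Filter Topology in
theorem hasAsymptoticDensity_choose_dvd_of_pos {c : ℝ} (hc0 : 0 < c) (hc : c ^ 2 < log 2) :
    HasAsymptoticDensity
      {m : ℕ | ∀ k : ℕ, (k : ℝ) ≤ exp (c * √(log (m : ℝ))) →
        (m + k).choose m ∣ (2 * m).choose m} 1 := by
  classical
  obtain ⟨z, C, d, hz0, hz1, hC, hcd, hev⟩ := exists_uniform_exp_bound hc0 hc
  have hx : Tendsto (fun N : ℕ => √(log (N : ℝ))) atTop atTop :=
    tendsto_sqrt_atTop.comp (tendsto_log_atTop.comp tendsto_natCast_atTop_atTop)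
  set f : ℝ → ℝ := fun x => 4 * exp (-(c * x)) + 4 * exp (c * x) * (C * exp (-(d * x))) with hf
  have hf0 : Tendsto f atTop (𝓝 0) := by
    have key : ∀ a : ℝ, 0 < a → Tendsto (fun x : ℝ => exp (-(a * x))) atTop (𝓝 0) := fun a ha =>
      tendsto_exp_neg_atTop_nhds_zero.comp (tendsto_id.const_mul_atTop ha)
    have h1 := ((key c hc0).const_mul 4).add ((key (d - c) (sub_pos.mpr hcd)).const_mul (4 * C))
    simp only [mul_zero, add_zero] at h1
    refine h1.congr fun x => ?_
    have : exp (-((d - c) * x)) = exp (c * x) * exp (-(d * x)) := by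
      rw [← exp_add]; ring_nf
    rw [hf, this]
    ring
  have hlim : Tendsto (fun N : ℕ => 1 - f (√(log (N : ℝ)))) atTop (𝓝 1) := by
    simpa using (hf0.comp hx).const_sub 1
  refine tendsto_of_tendsto_of_tendsto_of_le_of_le' hlim tendsto_const_nhds ?_ ?_
  · filter_upwards [hx.eventually hev, hx.eventually_ge_atTop c, eventually_gt_atTop 0]
      with N hN1 hN2 hN0
    set S := {m : ℕ | ∀ k : ℕ, (k : ℝ) ≤ exp (c * √(log (m : ℝ))) →
        (m + k).choose m ∣ (2 * m).choose m} with hS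
    have hbad := card_not_choose_dvd_le hc0 hN0 rfl hN2 hz0 hz1 (by positivity) hN1
      {m ∈ Finset.Icc 1 N | m ∉ S} (fun m hm => by
        obtain ⟨h1, h2⟩ := Finset.mem_filter.mp hm
        refine ⟨h1, ?_⟩
        simpa [hS] using h2)
    have hcard : (S ∩ Set.Icc 1 N).ncard = (Finset.filter (· ∈ S) (Finset.Icc 1 N)).card := by
      rw [← Set.ncard_coe_finset]
      congr 1
      ext m
      simp [and_comm]
    have hadd := Finset.card_filter_add_card_filter_not (s := Finset.Icc 1 N) (· ∈ S)
    rw [Nat.card_Icc, Nat.add_sub_cancel] at hadd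
    have haddR : ((Finset.filter (· ∈ S) (Finset.Icc 1 N)).card : ℝ) +
        (Finset.filter (· ∉ S) (Finset.Icc 1 N)).card = N := by exact_mod_cast hadd
    have hNR : (0 : ℝ) < N := by exact_mod_cast hN0
    rw [hcard, le_div_iff₀ hNR]
    simp only [hf]
    linarith
  · exact .of_forall (ncard_inter_Icc_div_le_one _)

theorem corollary1 (c : ℝ) (hc : c < Real.sqrt (Real.log 2)) :
    HasAsymptoticDensity
      {m : ℕ | ∀ k : ℕ, (k : ℝ) ≤ Real.exp (c * Real.sqrt (Real.log (m : ℝ))) →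
        (m + k).choose m ∣ (2 * m).choose m} 1 := by
  have hpos : 0 < Real.sqrt (Real.log 2) := Real.sqrt_pos.mpr (Real.log_pos (by norm_num))
  -- Raising `c` only shrinks the set, so a positive `b` may replace it.
  obtain ⟨b, hb, hb2⟩ := exists_between (max_lt hc hpos)
  obtain ⟨hcb, hb0⟩ := max_lt_iff.mp hb
  refine (hasAsymptoticDensity_choose_dvd_of_pos hb0 ((Real.lt_sqrt hb0.le).mp hb2)).mono_one
    fun m hm k hk => hm k (hk.trans ?_)
  gcongr
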